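/- Let $G$ be a finite connected graph. For a nonempty set $A\subseteq V(G)$, the Steiner distance $d(A)$ is the minimum number of edges in a subtree of $G$ whose vertex set contains $A$, and the $k$-Steiner Wiener index of $G$ is $SW_k(G)=\sum_{A\subseteq V(G),\,|A|=k} d(A)$. For integers $2\le d\le n-1$, let $\mathbf{T}_{d,n}$ be the tree obtained from a path of order $d+1$ by attaching $n-d-1$ pendent edges to one of its centre vertices. Let $T$ be a tree of order $n$ and diameter $d$, and let $k\in\{2,3,\ldots,n-1\}$. Then $$SW_k(T)\ \ge\ SW_k(\mathbf{T}_{d,n}).$$ Moreover, if $k\le n-\lceil d/2\rceil$, then equality implies that $T$ is isomorphic to $\mathbf{T}_{d,n}$. -/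

import Mathlib

namespace SteinerWiener

/-- The Steiner distance of a set `A` of vertices of `G`: the minimum number of edges in a
subtree of `G` whose vertex set contains `A`. -/
noncomputable def steinerDist {V : Type*} (G : SimpleGraph V) (A : Set V) : ℕ :=
  sInf {m : ℕ | ∃ H : G.Subgraph, H.coe.IsTree ∧ A ⊆ H.verts ∧ H.edgeSet.ncard = m}

/-- The `k`-Steiner Wiener index of `G`: the sum of the Steiner distances of all `k`-element
sets of vertices of `G`. -/
noncomputable def steinerWiener {V : Type*} [Fintype V] (k : ℕ) (G : SimpleGraph V) : ℕ :=
  ∑ A ∈ Finset.powersetCard k (Finset.univ : Finset V), steinerDist G (A : Set V)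

/-- The tree `𝐓_{d,n}` for `d + 1 ≤ n`. The vertices `0, 1, …, d` form, in this order, a path of
order `d + 1`, which has `d / 2` (rounded down) as a centre vertex; each of the remaining
`n - d - 1` vertices is joined to this centre vertex and to no other vertex. -/
def extremalTree (d n : ℕ) : SimpleGraph (Fin n) :=
  SimpleGraph.fromRel fun i j : Fin n =>
    ((i : ℕ) + 1 = (j : ℕ) ∧ (j : ℕ) ≤ d) ∨ ((i : ℕ) = d / 2 ∧ d < (j : ℕ))

end SteinerWiener

open Finset

namespace SteinerWiener

/-! In a tree the minimal subtree containing `A` consists of exactly the edges whose removal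
separates `A`. Counting pairs (edge, `k`-set) both ways turns `SW_k` into a sum over edges, where an
edge with a side of size `m` contributes `cutWeight n k m` (`steinerWiener_eq_sum_edgeWeight`,
`edgeWeight_eq`). This weight grows with the smaller side. On a diametral path the sides of the edge
from `p i` to `p (i + 1)` have at least `i + 1` and `d - i` vertices, and any other edge has sides
of size at least 1. Adding these bounds gives `extremalValue` (`IsPathSeq.extremalValue_le`), which
`𝐓_{d,n}` does not exceed (`steinerWiener_extremalTree_le`). For equality, the bound on `k` makes
the weight strictly monotone where needed, so every edge meets its bound (`IsTight`). Hence the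
vertices off the path are leaves hanging from one common centre of it. -/

/-- The number of `k`-subsets of an `n`-set that meet both parts of a partition into parts of
sizes `m` and `n - m`. -/
def cutWeight (n k m : ℕ) : ℕ := n.choose k - (m.choose k + (n - m).choose k)

/-! ### Monotonicity of the cut weight -/

lemma choose_lt_choose_left {a b j : ℕ} (hab : a < b) (hj : 1 ≤ j) (hjb : j ≤ b) :
    a.choose j < b.choose j := by
  obtain ⟨b, rfl⟩ : ∃ c, b = c + 1 := ⟨b - 1, by omega⟩
  obtain ⟨j, rfl⟩ : ∃ c, j = c + 1 := ⟨j - 1, by omega⟩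
  rw [Nat.choose_succ_succ' b j]
  have h1 : a.choose (j + 1) ≤ b.choose (j + 1) := Nat.choose_le_choose _ (by omega)
  have h2 : 0 < b.choose j := Nat.choose_pos (by omega)
  omega

/-- By Pascal's rule the right side exceeds the left by `(n - m - 1).choose k - m.choose k`. -/
lemma choose_add_choose_succ_le {n k m : ℕ} (hm : 2 * (m + 1) ≤ n) :
    (m + 1).choose (k + 1) + (n - (m + 1)).choose (k + 1) ≤
      m.choose (k + 1) + (n - m).choose (k + 1) := by
  obtain ⟨r, hr⟩ : ∃ r, n - m = r + 1 := ⟨n - m - 1, by omega⟩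
  have hr' : n - (m + 1) = r := by omega
  rw [hr, hr', Nat.choose_succ_succ', Nat.choose_succ_succ']
  have := Nat.choose_le_choose k (show m ≤ r by omega)
  omega

lemma choose_add_choose_succ_lt {n k m : ℕ} (hm : 2 * (m + 1) ≤ n) (hk : 1 ≤ k)
    (hkm : k + 1 ≤ n - m) :
    (m + 1).choose (k + 1) + (n - (m + 1)).choose (k + 1) <
      m.choose (k + 1) + (n - m).choose (k + 1) := by
  obtain ⟨r, hr⟩ : ∃ r, n - m = r + 1 := ⟨n - m - 1, by omega⟩
  have hr' : n - (m + 1) = r := by omega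
  rw [hr, hr', Nat.choose_succ_succ', Nat.choose_succ_succ']
  have := choose_lt_choose_left (show m < r by omega) hk (by omega)
  omega

lemma choose_add_choose_anti {n k m m' : ℕ} (hk : 1 ≤ k) (h : m ≤ m') (hm : 2 * m' ≤ n) :
    m'.choose k + (n - m').choose k ≤ m.choose k + (n - m).choose k := by
  obtain ⟨k, rfl⟩ : ∃ c, k = c + 1 := ⟨k - 1, by omega⟩
  induction m', h using Nat.le_induction with
  | base => exact le_rfl
  | succ i _ ih => exact (choose_add_choose_succ_le hm).trans (ih (by omega))

lemma choose_add_choose_strictAnti {n k m m' : ℕ} (hk : 2 ≤ k) (h : m < m') (hm : 2 * m' ≤ n)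
    (hkm : k ≤ n - m) :
    m'.choose k + (n - m').choose k < m.choose k + (n - m).choose k := by
  refine (choose_add_choose_anti (by omega) h hm).trans_lt ?_
  obtain ⟨k, rfl⟩ : ∃ c, k = c + 1 := ⟨k - 1, by omega⟩
  exact choose_add_choose_succ_lt (by omega) (by omega) hkm

lemma choose_add_choose_le {n k m : ℕ} (hk : 1 ≤ k) (hm : m ≤ n) :
    m.choose k + (n - m).choose k ≤ n.choose k := by
  rcases le_total (2 * m) n with h | h
  · have := choose_add_choose_anti hk (Nat.zero_le m) h
    rwa [Nat.choose_eq_zero_of_lt (show 0 < k by omega), zero_add, Nat.sub_zero] at this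
  · have := choose_add_choose_anti hk (Nat.zero_le (n - m)) (show 2 * (n - m) ≤ n by omega)
    rw [Nat.choose_eq_zero_of_lt (show 0 < k by omega), zero_add, Nat.sub_zero,
      Nat.sub_sub_self hm] at this
    omega

lemma cutWeight_mono {n k m m' : ℕ} (hk : 1 ≤ k) (h : m ≤ m') (hm : 2 * m' ≤ n) :
    cutWeight n k m ≤ cutWeight n k m' :=
  Nat.sub_le_sub_left (choose_add_choose_anti hk h hm) _

lemma cutWeight_strictMono {n k m m' : ℕ} (hk : 2 ≤ k) (h : m < m') (hm : 2 * m' ≤ n)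
    (hkm : k ≤ n - m) : cutWeight n k m < cutWeight n k m' := by
  have h1 := choose_add_choose_strictAnti hk h hm hkm
  have h2 := choose_add_choose_le (k := k) (by omega) (show m ≤ n by omega)
  unfold cutWeight
  omega

lemma cutWeight_symm {n k m : ℕ} (hm : m ≤ n) : cutWeight n k (n - m) = cutWeight n k m := by
  unfold cutWeight
  rw [Nat.sub_sub_self hm, add_comm]

/-- Here `s` is either side of an edge, possibly the larger one; beyond `n / 2` it is reflected to
`n - s`. -/
lemma cutWeight_le_of_le {n k m s : ℕ} (hk : 1 ≤ k) (h1 : m ≤ s) (h2 : m + s ≤ n) :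
    cutWeight n k m ≤ cutWeight n k s := by
  rcases le_total (2 * s) n with h | h
  · exact cutWeight_mono hk h1 h
  · rw [← cutWeight_symm (show s ≤ n by omega)]
    exact cutWeight_mono hk (by omega) (by omega)

lemma eq_or_of_cutWeight_eq {n k m s : ℕ} (hk : 2 ≤ k) (h1 : m ≤ s) (h2 : m + s ≤ n)
    (hkm : k ≤ n - m) (h : cutWeight n k m = cutWeight n k s) : s = m ∨ m + s = n := by
  by_contra! hne
  rcases le_total (2 * s) n with hs | hs
  · exact (cutWeight_strictMono hk (show m < s by omega) hs hkm).ne h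
  · rw [← cutWeight_symm (show s ≤ n by omega)] at h
    exact (cutWeight_strictMono hk (show m < n - s by omega) (by omega) hkm).ne h

/-! ### Steiner distance as the number of separating edges -/

variable {V : Type*}

/-- Removing the edge `e` from `G` disconnects two vertices of `A`. -/
def Separates (G : SimpleGraph V) (e : Sym2 V) (A : Set V) : Prop :=
  ∃ a ∈ A, ∃ b ∈ A, ¬ (G.deleteEdges {e}).Reachable a b

lemma reachable_deleteEdges_or' {G : SimpleGraph V} (u v : V) {a w : V} (p : G.Walk a w) :
    (G.deleteEdges {s(u, v)}).Reachable a w ∨ (G.deleteEdges {s(u, v)}).Reachable u w ∨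
      (G.deleteEdges {s(u, v)}).Reachable v w := by
  induction p with
  | nil => exact .inl .rfl
  | @cons a b w h p ih =>
    rcases ih with ih | ih
    · by_cases he : s(a, b) = s(u, v)
      · rcases Sym2.eq_iff.1 he with ⟨rfl, rfl⟩ | ⟨rfl, rfl⟩
        · exact .inr (.inr ih)
        · exact .inr (.inl ih)
      · have hab : (G.deleteEdges {s(u, v)}).Adj a b := by
          simpa [SimpleGraph.deleteEdges_adj] using ⟨h, by simpa using he⟩
        exact .inl (hab.reachable.trans ih)
    · exact .inr ih

lemma reachable_deleteEdges_or {G : SimpleGraph V} (hG : G.Connected) (u v w : V) :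
    (G.deleteEdges {s(u, v)}).Reachable u w ∨ (G.deleteEdges {s(u, v)}).Reachable v w := by
  obtain ⟨p⟩ := hG u w
  rcases reachable_deleteEdges_or' u v p with h | h | h
  exacts [.inl h, .inl h, .inr h]

lemma not_reachable_deleteEdges {G : SimpleGraph V} (hG : G.IsTree) {u v : V} (h : G.Adj u v) :
    ¬ (G.deleteEdges {s(u, v)}).Reachable u v :=
  SimpleGraph.isBridge_iff.1 (SimpleGraph.isAcyclic_iff_forall_adj_isBridge.1 hG.isAcyclic h)

section Side

variable [Fintype V]

open Classical in
/-- The vertices on the side of `u` after the edge `uv` is removed from `G`. -/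
noncomputable def side (G : SimpleGraph V) (u v : V) : Finset V :=
  {w | (G.deleteEdges {s(u, v)}).Reachable u w}

lemma mem_side {G : SimpleGraph V} {u v w : V} :
    w ∈ side G u v ↔ (G.deleteEdges {s(u, v)}).Reachable u w := by
  simp [side]

lemma self_mem_side (G : SimpleGraph V) (u v : V) : u ∈ side G u v := mem_side.2 .rfl

lemma mem_side_swap {G : SimpleGraph V} (hG : G.IsTree) {u v w : V} (h : G.Adj u v) :
    w ∈ side G v u ↔ w ∉ side G u v := by
  rw [mem_side, mem_side, Sym2.eq_swap]
  refine ⟨fun h1 h2 ↦ not_reachable_deleteEdges hG h (h2.trans h1.symm), fun h1 ↦ ?_⟩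
  exact (reachable_deleteEdges_or hG.connected u v w).resolve_left h1

lemma mem_side_of_adj {G : SimpleGraph V} {u v a b : V} (h : G.Adj a b) (hne : s(a, b) ≠ s(u, v))
    (ha : a ∈ side G u v) : b ∈ side G u v := by
  rw [mem_side] at *
  have hab : (G.deleteEdges {s(u, v)}).Adj a b := by
    simpa [SimpleGraph.deleteEdges_adj] using ⟨h, by simpa using hne⟩
  exact ha.trans hab.reachable

/-- Bounds a side from above by any set containing `u` that is closed under the other edges. -/
lemma side_subset {G : SimpleGraph V} {u v : V} {S : Set V} (hu : u ∈ S)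
    (hS : ∀ a b, G.Adj a b → s(a, b) ≠ s(u, v) → a ∈ S → b ∈ S) {w : V} (hw : w ∈ side G u v) :
    w ∈ S := by
  obtain ⟨p⟩ := mem_side.1 hw
  have : ∀ {a b : V} (q : (G.deleteEdges {s(u, v)}).Walk a b), a ∈ S → b ∈ S := by
    intro a b q
    induction q with
    | nil => exact id
    | cons h q ih =>
      intro ha
      rw [SimpleGraph.deleteEdges_adj] at h
      exact ih (hS _ _ h.1 (by simpa using h.2) ha)
  exact this p hu

lemma card_side_add {G : SimpleGraph V} (hG : G.IsTree) {u v : V} (h : G.Adj u v) :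
    #(side G u v) + #(side G v u) = Fintype.card V := by
  classical
  rw [← Finset.card_add_card_compl (side G u v)]
  congr 2
  ext w
  rw [mem_side_swap hG h, Finset.mem_compl]

lemma separates_iff {G : SimpleGraph V} (hG : G.IsTree) {u v : V} (h : G.Adj u v)
    (A : Finset V) :
    Separates G s(u, v) A ↔ ¬ A ⊆ side G u v ∧ ¬ A ⊆ side G v u := by
  constructor
  · rintro ⟨a, ha, b, hb, hab⟩
    refine ⟨fun hA ↦ hab ?_, fun hA ↦ hab ?_⟩
    · exact (mem_side.1 (hA ha)).symm.trans (mem_side.1 (hA hb))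
    · have h1 := mem_side.1 (hA ha)
      have h2 := mem_side.1 (hA hb)
      rw [Sym2.eq_swap] at h1 h2
      exact h1.symm.trans h2
  · rintro ⟨h1, h2⟩
    obtain ⟨a, ha, ha'⟩ := Finset.not_subset.1 h1
    obtain ⟨b, hb, hb'⟩ := Finset.not_subset.1 h2
    rw [mem_side_swap hG h, not_not] at hb'
    exact ⟨b, hb, a, ha, fun hab ↦ ha' (mem_side.2 ((mem_side.1 hb').trans hab))⟩

open Classical in
/-- The number of `k`-element sets of vertices that are separated by removing `e` from `G`. -/
noncomputable def edgeWeight (k : ℕ) (G : SimpleGraph V) (e : Sym2 V) : ℕ :=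
  #((powersetCard k univ).filter fun A : Finset V ↦ Separates G e A)

lemma edgeWeight_eq {G : SimpleGraph V} (hG : G.IsTree) {u v : V} (h : G.Adj u v) {k : ℕ}
    (hk : 1 ≤ k) :
    edgeWeight k G s(u, v) = cutWeight (Fintype.card V) k #(side G u v) := by
  classical
  -- Only the empty set could lie in both sides, and `1 ≤ k` excludes it.
  have hdisj : Disjoint (powersetCard k (side G u v)) (powersetCard k (side G v u)) := by
    rw [Finset.disjoint_left]
    intro A h1 h2
    rw [mem_powersetCard] at h1 h2
    obtain ⟨a, ha⟩ := Finset.card_pos.1 (by omega : 0 < #A)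
    exact (mem_side_swap hG h).1 (h2.1 ha) (h1.1 ha)
  have heq : ((powersetCard k univ).filter fun A : Finset V ↦ Separates G s(u, v) A) =
      powersetCard k univ \ (powersetCard k (side G u v) ∪ powersetCard k (side G v u)) := by
    ext A
    simp only [mem_filter, mem_sdiff, mem_union, mem_powersetCard, separates_iff hG h]
    tauto
  have hsub : powersetCard k (side G u v) ∪ powersetCard k (side G v u) ⊆ powersetCard k univ :=
    Finset.union_subset (powersetCard_mono (subset_univ _)) (powersetCard_mono (subset_univ _))
  rw [edgeWeight, heq, card_sdiff_of_subset hsub, card_union_of_disjoint hdisj]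
  simp only [card_powersetCard, card_univ]
  rw [cutWeight, ← card_side_add hG h, Nat.add_sub_cancel_left]

end Side

lemma mem_edgeSet_of_separates {G : SimpleGraph V} {e : Sym2 V} {A : Set V}
    (h : Separates G e A) {H : G.Subgraph} (hH : H.coe.Connected) (hA : A ⊆ H.verts) :
    e ∈ H.edgeSet := by
  obtain ⟨a, ha, b, hb, hab⟩ := h
  obtain ⟨p⟩ := hH ⟨a, hA ha⟩ ⟨b, hA hb⟩
  by_contra he
  apply hab
  have hle : ∀ x y, H.coe.Adj x y → (G.deleteEdges {e}).Adj x y := by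
    intro x y hxy
    rw [SimpleGraph.deleteEdges_adj]
    refine ⟨H.adj_sub hxy, fun h' ↦ he ?_⟩
    rw [← Set.mem_singleton_iff.1 h']
    exact hxy
  exact ⟨p.map ⟨Subtype.val, fun {x y} ↦ hle x y⟩⟩

lemma card_separates_le_steinerDist [Fintype V] {G : SimpleGraph V} (hG : G.IsTree) (A : Set V)
    (s : Finset (Sym2 V)) (hs : ∀ e ∈ s, Separates G e A) : #s ≤ steinerDist G A := by
  unfold steinerDist
  refine le_csInf ?_ ?_
  -- The whole tree is a candidate, so the infimum is not the default value of `sInf ∅`.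
  · refine ⟨_, ⊤, ?_, fun _ _ ↦ trivial, rfl⟩
    exact SimpleGraph.Subgraph.topIso.symm.isTree_iff.1 hG
  · rintro m ⟨H, hH, hA, rfl⟩
    classical
    rw [← Set.ncard_coe_finset]
    exact Set.ncard_le_ncard (fun e he ↦ mem_edgeSet_of_separates (hs e he) hH.connected hA)
      (Set.toFinite _)

/-- A path from `a` to `b` avoiding `e` would contradict uniqueness of paths in a tree. -/
lemma separates_of_mem_edges {G : SimpleGraph V} (hG : G.IsTree) {a b : V} {p : G.Walk a b}
    (hp : p.IsPath) {e : Sym2 V} (he : e ∈ p.edges) {A : Set V} (ha : a ∈ A) (hb : b ∈ A) :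
    Separates G e A := by
  refine ⟨a, ha, b, hb, fun h ↦ ?_⟩
  obtain ⟨q, hq⟩ := h.exists_isPath
  have hq' := hq.mapLe (G.deleteEdges_le {e})
  have := congrArg Subtype.val
    ((hG.isAcyclic.subsingleton_path a b).elim ⟨p, hp⟩ ⟨_, hq'⟩)
  simp only at this
  rw [this, SimpleGraph.Walk.edges_mapLe_eq_edges] at he
  have := q.edges_subset_edgeSet he
  simp [SimpleGraph.edgeSet_deleteEdges] at this

lemma steinerDist_le_card [Fintype V] {G : SimpleGraph V} (hG : G.IsTree) {A : Set V}
    (hA : A.Nonempty) (s : Finset (Sym2 V)) (hs : ∀ e, Separates G e A → e ∈ G.edgeSet → e ∈ s) :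
    steinerDist G A ≤ #s := by
  obtain ⟨a, ha⟩ := hA
  choose p hp using fun b : V ↦ hG.connected.exists_isPath a b
  -- The union of the paths from one vertex of `A` to all the others is a subtree in which every
  -- edge separates `A`.
  let H : G.Subgraph := ⨆ b : A, (p b).toSubgraph
  have hmem : ∀ b ∈ A, (p b).toSubgraph ≤ H := fun b hb ↦
    le_iSup (fun b : A ↦ (p b).toSubgraph) ⟨b, hb⟩
  have hconn : H.Connected := by
    rw [SimpleGraph.Subgraph.connected_iff_forall_exists_walk_subgraph]
    have ha' : ∀ u ∈ H.verts, ∃ q : G.Walk a u, q.toSubgraph ≤ H := by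
      intro u hu
      simp only [H, SimpleGraph.Subgraph.verts_iSup, Set.mem_iUnion] at hu
      obtain ⟨b, hb⟩ := hu
      classical
      rw [SimpleGraph.Walk.mem_verts_toSubgraph] at hb
      refine ⟨(p b).takeUntil u hb, le_trans ?_ (hmem b b.2)⟩
      conv_rhs => rw [← (p b).take_spec hb, SimpleGraph.Walk.toSubgraph_append]
      exact le_sup_left
    refine ⟨⟨a, (hmem a ha).1 (by simp)⟩, fun {u v} hu hv ↦ ?_⟩
    obtain ⟨q, hq⟩ := ha' u hu
    obtain ⟨r, hr⟩ := ha' v hv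
    refine ⟨q.reverse.append r, ?_⟩
    rw [SimpleGraph.Walk.toSubgraph_append, SimpleGraph.Walk.toSubgraph_reverse]
    exact sup_le hq hr
  have hle : H.edgeSet.ncard ≤ #s := by
    rw [← Set.ncard_coe_finset]
    refine Set.ncard_le_ncard (fun e he ↦ hs e ?_ (H.edgeSet_subset he)) (Set.toFinite _)
    simp only [H, SimpleGraph.Subgraph.edgeSet_iSup, Set.mem_iUnion] at he
    obtain ⟨b, hb⟩ := he
    rw [SimpleGraph.Walk.mem_edges_toSubgraph] at hb
    exact separates_of_mem_edges hG (hp b) hb ha b.2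
  refine le_trans (Nat.sInf_le ⟨H, ⟨hconn.coe, hG.isAcyclic.subgraph H⟩, ?_, rfl⟩) hle
  intro b hb
  exact (hmem b hb).1 (by simp)

lemma steinerWiener_eq_sum_edgeWeight [Fintype V] {G : SimpleGraph V} [Fintype G.edgeSet]
    (hG : G.IsTree) {k : ℕ} (hk : 1 ≤ k) :
    steinerWiener k G = ∑ e ∈ G.edgeFinset, edgeWeight k G e := by
  classical
  simp only [edgeWeight, card_eq_sum_ones, sum_filter]
  rw [sum_comm, steinerWiener]
  refine sum_congr rfl fun A hA ↦ ?_
  rw [← sum_filter, ← card_eq_sum_ones]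
  have hA' : (A : Set V).Nonempty := by
    rw [Finset.coe_nonempty, ← Finset.card_pos, (mem_powersetCard.1 hA).2]
    exact hk
  apply le_antisymm
  · exact steinerDist_le_card hG hA' _ fun e h1 h2 ↦ by simp [h1, h2]
  · exact card_separates_le_steinerDist hG _ _ fun e he ↦ (mem_filter.1 he).2

end SteinerWiener

/-! ### Lower bound along a diametral path -/

namespace SteinerWiener

variable {V : Type*}

/-- The vertices `p 0, …, p d` form a path of `G` in this order. -/
structure IsPathSeq (G : SimpleGraph V) (d : ℕ) (p : ℕ → V) : Prop where
  adj : ∀ i < d, G.Adj (p i) (p (i + 1))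
  inj : ∀ i ≤ d, ∀ j ≤ d, p i = p j → i = j

namespace IsPathSeq

variable {G : SimpleGraph V} {d : ℕ} {p : ℕ → V}

lemma edge_inj (hp : IsPathSeq G d p) {i j : ℕ} (hi : i < d) (hj : j < d)
    (h : s(p i, p (i + 1)) = s(p j, p (j + 1))) : i = j := by
  rcases Sym2.eq_iff.1 h with ⟨h1, -⟩ | ⟨h1, h2⟩
  · exact hp.inj i hi.le j hj.le h1
  · have := hp.inj i hi.le (j + 1) hj h1
    have := hp.inj (i + 1) hi j hj.le h2
    omega

lemma reverse (hp : IsPathSeq G d p) : IsPathSeq G d (fun i ↦ p (d - i)) where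
  adj i hi := by
    have := (hp.adj (d - (i + 1)) (by omega)).symm
    rwa [show d - (i + 1) + 1 = d - i by omega] at this
  inj i hi j hj h := by
    have := hp.inj _ (by omega) _ (by omega) h
    omega

lemma card_image_Icc [DecidableEq V] (hp : IsPathSeq G d p) {a b : ℕ} (hb : b ≤ d) :
    #((Icc a b).image p) = b + 1 - a := by
  rw [card_image_of_injOn, Nat.card_Icc]
  intro i hi j hj h
  simp only [coe_Icc, Set.mem_Icc] at hi hj
  exact hp.inj i (by omega) j (by omega) h

variable [Fintype V]

lemma succ_le_card (hp : IsPathSeq G d p) : d + 1 ≤ Fintype.card V := by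
  classical
  have h : #((range (d + 1)).image p) = d + 1 := by
    rw [card_image_of_injOn, card_range]
    intro i hi j hj h
    simp only [coe_range, Set.mem_Iio] at hi hj
    exact hp.inj i (by omega) j (by omega) h
  rw [← h]
  exact card_le_univ _

lemma mem_side_left (hp : IsPathSeq G d p) {i j : ℕ} (hi : i < d) (hj : j ≤ i) :
    p j ∈ side G (p i) (p (i + 1)) := by
  induction hj using Nat.decreasingInduction with
  | self => exact self_mem_side _ _ _
  | of_succ j hj ih =>
    refine mem_side_of_adj (hp.adj j (by omega)).symm (fun h ↦ ?_) ih
    rw [Sym2.eq_swap] at h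
    have := hp.edge_inj (by omega) hi h
    omega

lemma mem_side_right (hp : IsPathSeq G d p) {i j : ℕ} (hj : i + 1 ≤ j) (hjd : j ≤ d) :
    p j ∈ side G (p (i + 1)) (p i) := by
  induction j, hj using Nat.le_induction with
  | base => exact self_mem_side _ _ _
  | succ j hj ih =>
    refine mem_side_of_adj (hp.adj j (by omega)) (fun h ↦ ?_) (ih (by omega))
    rw [Sym2.eq_swap (a := p (i + 1))] at h
    have := hp.edge_inj (by omega) (by omega) h
    omega

lemma mem_side_of_forall_ne (hp : IsPathSeq G d p) {u v : V}
    (hne : ∀ i < d, s(u, v) ≠ s(p i, p (i + 1))) (h0 : p 0 ∈ side G u v) {j : ℕ} (hj : j ≤ d) :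
    p j ∈ side G u v := by
  induction j with
  | zero => exact h0
  | succ j ih => exact mem_side_of_adj (hp.adj j hj) (hne j hj).symm (ih (by omega))

lemma image_subset_left [DecidableEq V] (hp : IsPathSeq G d p) {i : ℕ} (hi : i < d) :
    (Icc 0 i).image p ⊆ side G (p i) (p (i + 1)) := by
  intro x hx
  obtain ⟨j, hj, rfl⟩ := mem_image.1 hx
  exact hp.mem_side_left hi (mem_Icc.1 hj).2

lemma image_subset_right [DecidableEq V] (hp : IsPathSeq G d p) {i : ℕ} :
    (Icc (i + 1) d).image p ⊆ side G (p (i + 1)) (p i) := by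
  intro x hx
  obtain ⟨j, hj, rfl⟩ := mem_image.1 hx
  exact hp.mem_side_right (mem_Icc.1 hj).1 (mem_Icc.1 hj).2

lemma le_card_side_left (hp : IsPathSeq G d p) {i : ℕ} (hi : i < d) :
    i + 1 ≤ #(side G (p i) (p (i + 1))) := by
  classical
  have := card_le_card (hp.image_subset_left hi)
  rwa [hp.card_image_Icc hi.le] at this

lemma le_card_side_right (hp : IsPathSeq G d p) {i : ℕ} (hi : i < d) :
    d - i ≤ #(side G (p (i + 1)) (p i)) := by
  classical
  have := card_le_card (hp.image_subset_right (i := i))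
  rw [hp.card_image_Icc le_rfl] at this
  omega

end IsPathSeq

/-- The `k`-Steiner Wiener index of `𝐓_{d,n}`, as a sum of contributions of edges. -/
def extremalValue (n k d : ℕ) : ℕ :=
  ∑ i ∈ range d, cutWeight n k (min (i + 1) (d - i)) + (n - 1 - d) * cutWeight n k 1

open Classical in
/-- The edges of the path `p 0, …, p d`. -/
noncomputable def pathEdges (d : ℕ) (p : ℕ → V) : Finset (Sym2 V) :=
  (range d).image fun i ↦ s(p i, p (i + 1))

lemma mem_pathEdges {d : ℕ} {p : ℕ → V} {e : Sym2 V} :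
    e ∈ pathEdges d p ↔ ∃ i < d, s(p i, p (i + 1)) = e := by
  simp [pathEdges]

section Bound

variable [Fintype V] {G : SimpleGraph V} {d : ℕ} {p : ℕ → V} {k : ℕ}

lemma cutWeight_one_le_edgeWeight (hG : G.IsTree) (hk : 1 ≤ k) {e : Sym2 V} (he : e ∈ G.edgeSet) :
    cutWeight (Fintype.card V) k 1 ≤ edgeWeight k G e := by
  induction e with
  | h u v =>
    rw [SimpleGraph.mem_edgeSet] at he
    rw [edgeWeight_eq hG he hk]
    have h1 := card_side_add hG he
    have h2 := card_pos.2 ⟨u, self_mem_side G u v⟩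
    have h3 := card_pos.2 ⟨v, self_mem_side G v u⟩
    exact cutWeight_le_of_le hk h2 (by omega)

lemma IsPathSeq.cutWeight_le_edgeWeight (hp : IsPathSeq G d p) (hG : G.IsTree) (hk : 1 ≤ k)
    {i : ℕ} (hi : i < d) :
    cutWeight (Fintype.card V) k (min (i + 1) (d - i)) ≤
      edgeWeight k G s(p i, p (i + 1)) := by
  rw [edgeWeight_eq hG (hp.adj i hi) hk]
  have h1 := card_side_add hG (hp.adj i hi)
  have h2 := hp.le_card_side_left hi
  have h3 := hp.le_card_side_right hi
  exact cutWeight_le_of_le hk (by omega) (by omega)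

open Classical in
lemma IsPathSeq.sum_edgeWeight (hp : IsPathSeq G d p) :
    ∑ e ∈ G.edgeFinset, edgeWeight k G e =
      ∑ i ∈ range d, edgeWeight k G s(p i, p (i + 1)) +
        ∑ e ∈ G.edgeFinset \ pathEdges d p, edgeWeight k G e := by
  have hsub : pathEdges d p ⊆ G.edgeFinset := by
    intro e he
    obtain ⟨i, hi, rfl⟩ := mem_pathEdges.1 he
    simpa using hp.adj i hi
  rw [← sum_sdiff hsub, add_comm]
  congr 1
  rw [pathEdges, sum_image]
  intro i hi j hj h
  simp only [coe_range, Set.mem_Iio] at hi hj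
  exact hp.edge_inj hi hj h

open Classical in
lemma IsPathSeq.card_edgeFinset_sdiff (hp : IsPathSeq G d p) (hG : G.IsTree) :
    #(G.edgeFinset \ pathEdges d p) = Fintype.card V - 1 - d := by
  have hsub : pathEdges d p ⊆ G.edgeFinset := by
    intro e he
    obtain ⟨i, hi, rfl⟩ := mem_pathEdges.1 he
    simpa using hp.adj i hi
  have h1 := hG.card_edgeFinset
  have h2 : #(pathEdges d p) = d := by
    rw [pathEdges, card_image_of_injOn, card_range]
    intro i hi j hj h
    simp only [coe_range, Set.mem_Iio] at hi hj
    exact hp.edge_inj hi hj h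
  rw [card_sdiff_of_subset hsub, h2, ← h1, Nat.add_sub_cancel]

open Classical in
lemma IsPathSeq.sum_off_path_ge (hp : IsPathSeq G d p) (hG : G.IsTree) (hk : 1 ≤ k) :
    (Fintype.card V - 1 - d) * cutWeight (Fintype.card V) k 1 ≤
      ∑ e ∈ G.edgeFinset \ pathEdges d p, edgeWeight k G e := by
  rw [← hp.card_edgeFinset_sdiff hG, ← smul_eq_mul]
  refine card_nsmul_le_sum _ _ _ fun e he ↦ cutWeight_one_le_edgeWeight hG hk ?_
  simpa using (mem_sdiff.1 he).1

lemma IsPathSeq.extremalValue_le (hp : IsPathSeq G d p) (hG : G.IsTree) (hk : 1 ≤ k) :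
    extremalValue (Fintype.card V) k d ≤ steinerWiener k G := by
  classical
  rw [steinerWiener_eq_sum_edgeWeight hG hk, hp.sum_edgeWeight]
  exact add_le_add (sum_le_sum fun i hi ↦ hp.cutWeight_le_edgeWeight hG hk (mem_range.1 hi))
    (hp.sum_off_path_ge hG hk)

/-- The lower bound holds edge by edge, so a total at the minimum forces equality at each edge. -/
lemma IsPathSeq.edgeWeight_eq_of_le (hp : IsPathSeq G d p) (hG : G.IsTree) (hk : 1 ≤ k)
    (h : steinerWiener k G ≤ extremalValue (Fintype.card V) k d) :
    (∀ i < d, cutWeight (Fintype.card V) k (min (i + 1) (d - i)) =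
      edgeWeight k G s(p i, p (i + 1))) ∧
    ∀ e ∈ G.edgeSet, e ∉ pathEdges d p →
      cutWeight (Fintype.card V) k 1 = edgeWeight k G e := by
  classical
  rw [steinerWiener_eq_sum_edgeWeight hG hk, hp.sum_edgeWeight, extremalValue] at h
  have h1 : ∀ i ∈ range d, cutWeight (Fintype.card V) k (min (i + 1) (d - i)) ≤
      edgeWeight k G s(p i, p (i + 1)) :=
    fun i hi ↦ hp.cutWeight_le_edgeWeight hG hk (mem_range.1 hi)
  have h2 := sum_le_sum h1
  have h3 := hp.sum_off_path_ge hG hk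
  constructor
  · intro i hi
    exact (sum_eq_sum_iff_of_le h1).1 (by omega) i (mem_range.2 hi)
  · intro e he hne
    have h4 : ∀ e ∈ G.edgeFinset \ pathEdges d p, cutWeight (Fintype.card V) k 1 ≤
        edgeWeight k G e := by
      intro e he
      exact cutWeight_one_le_edgeWeight hG hk (by simpa using (mem_sdiff.1 he).1)
    refine (sum_eq_sum_iff_of_le h4).1 ?_ e (by simp [he, hne])
    rw [sum_const, hp.card_edgeFinset_sdiff hG, smul_eq_mul]
    omega

end Bound

lemma exists_isPathSeq_diam {G : SimpleGraph V} (hG : G.Connected) :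
    ∃ p : ℕ → V, IsPathSeq G G.diam p := by
  have := hG.nonempty
  obtain ⟨u, v, huv⟩ := G.exists_dist_eq_diam
  obtain ⟨q, hq, hl⟩ := hG.exists_path_of_dist u v
  rw [huv] at hl
  refine ⟨q.getVert, fun i hi ↦ q.adj_getVert_succ (by omega), fun i hi j hj h ↦ ?_⟩
  exact hq.getVert_injOn (by simp; omega) (by simp; omega) h

end SteinerWiener

/-! ### Upper bound for the extremal tree -/

namespace SteinerWiener

lemma extremalTree_adj {d n : ℕ} {i j : Fin n} :
    (extremalTree d n).Adj i j ↔ (i : ℕ) ≠ j ∧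
      ((((i : ℕ) + 1 = j ∧ (j : ℕ) ≤ d) ∨ ((i : ℕ) = d / 2 ∧ d < j)) ∨
        (((j : ℕ) + 1 = i ∧ (i : ℕ) ≤ d) ∨ ((j : ℕ) = d / 2 ∧ d < i))) := by
  rw [extremalTree, SimpleGraph.fromRel_adj, ne_eq, Fin.ext_iff]

/-- The neighbour of the vertex `j + 1` of `𝐓_{d,N+1}` on its way to the vertex `0`. -/
def parent (d N : ℕ) (j : Fin N) : Fin (N + 1) :=
  ⟨if (j : ℕ) < d then j else d / 2, by split <;> omega⟩

lemma extremalTree_adj_parent {d N : ℕ} (j : Fin N) :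
    (extremalTree d (N + 1)).Adj j.succ (parent d N j) := by
  rw [extremalTree_adj]
  simp only [parent, Fin.val_succ]
  split <;> omega

lemma exists_eq_parent {d N : ℕ} {e : Sym2 (Fin (N + 1))}
    (he : e ∈ (extremalTree d (N + 1)).edgeSet) : ∃ j : Fin N, s(j.succ, parent d N j) = e := by
  induction e with
  | h u v =>
    rw [SimpleGraph.mem_edgeSet] at he
    wlog huv : (u : ℕ) < v generalizing u v
    · obtain ⟨j, hj⟩ := this v u he.symm (by have := he.ne; omega)
      exact ⟨j, hj.trans Sym2.eq_swap⟩
    rw [extremalTree_adj] at he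
    obtain ⟨v, hv⟩ := v
    simp only at huv he
    refine ⟨⟨v - 1, by omega⟩, ?_⟩
    rw [Sym2.eq_swap]
    congr 2 <;> ext <;> simp only [parent, Fin.val_succ]
    · split <;> omega
    · omega

lemma edgeFinset_extremalTree {d N : ℕ} [Fintype (extremalTree d (N + 1)).edgeSet] :
    (extremalTree d (N + 1)).edgeFinset =
      (univ : Finset (Fin N)).image fun j ↦ s(j.succ, parent d N j) := by
  ext e
  rw [SimpleGraph.mem_edgeFinset, mem_image]
  constructor
  · intro he
    obtain ⟨j, hj⟩ := exists_eq_parent he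
    exact ⟨j, mem_univ _, hj⟩
  · rintro ⟨j, -, rfl⟩
    exact extremalTree_adj_parent j

lemma extremalTree_isTree {d N : ℕ} : (extremalTree d (N + 1)).IsTree := by
  classical
  have hconn : (extremalTree d (N + 1)).Connected := by
    rw [SimpleGraph.connected_iff_exists_forall_reachable]
    refine ⟨0, fun v ↦ ?_⟩
    obtain ⟨v, hv⟩ := v
    induction v using Nat.strong_induction_on with
    | _ v ih =>
      rcases v with - | v
      · exact .rfl
      · have h := extremalTree_adj_parent (d := d) (N := N) ⟨v, by omega⟩
        refine (ih _ ?_ _).trans h.symm.reachable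
        simp only
        split <;> omega
  -- The parent edges number at most `N`, the least a connected graph on `N + 1` vertices can have.
  refine SimpleGraph.isTree_iff_connected_and_card.2 ⟨hconn, ?_⟩
  refine le_antisymm ?_ hconn.card_vert_le_card_edgeSet_add_one
  rw [Nat.card_eq_fintype_card, Nat.card_eq_fintype_card, ← SimpleGraph.edgeFinset_card,
    edgeFinset_extremalTree, Fintype.card_fin]
  have : #((univ : Finset (Fin N)).image fun j ↦ s(j.succ, parent d N j)) ≤ #univ := card_image_le
  simpa using this

lemma sum_edgeFinset_extremalTree {d N : ℕ} [Fintype (extremalTree d (N + 1)).edgeSet]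
    (f : Sym2 (Fin (N + 1)) → ℕ) :
    ∑ e ∈ (extremalTree d (N + 1)).edgeFinset, f e = ∑ j : Fin N, f s(j.succ, parent d N j) := by
  classical
  have hcard := (extremalTree_isTree (d := d) (N := N)).card_edgeFinset
  rw [edgeFinset_extremalTree] at hcard ⊢
  refine sum_image (card_image_iff.1 ?_)
  simpa using hcard

lemma edgeWeight_le_of_closed {V : Type*} [Fintype V] {G : SimpleGraph V} (hG : G.IsTree) {u v : V}
    (h : G.Adj u v) {k m n : ℕ} (hn : Fintype.card V = n) (hk : 1 ≤ k) (S : Finset V) (hu : u ∈ S)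
    (hS : ∀ a b, G.Adj a b → s(a, b) ≠ s(u, v) → a ∈ S → b ∈ S) (hm : #S ≤ m)
    (hmn : 2 * m ≤ n) : edgeWeight k G s(u, v) ≤ cutWeight n k m := by
  subst hn
  rw [edgeWeight_eq hG h hk]
  refine cutWeight_mono hk (le_trans (card_le_card ?_) hm) hmn
  exact fun w hw ↦ side_subset (S := S) (by simpa using hu) (by simpa using hS) hw

lemma card_fin_filter_le {n a b : ℕ} (S : Finset (Fin n))
    (hS : ∀ x ∈ S, a ≤ (x : ℕ) ∧ (x : ℕ) < b) : #S ≤ b - a := by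
  rw [← Nat.card_Ico, ← card_map Fin.valEmbedding]
  refine card_le_card fun x hx ↦ ?_
  obtain ⟨y, hy, rfl⟩ := mem_map.1 hx
  exact mem_Ico.2 (hS y hy)

lemma edgeWeight_extremalTree_le {d N k : ℕ} (hd : d ≤ N) (hk : 1 ≤ k) (j : Fin N) :
    edgeWeight k (extremalTree d (N + 1)) s(j.succ, parent d N j) ≤
      cutWeight (N + 1) k (if (j : ℕ) < d then min (j + 1) (d - j) else 1) := by
  have hT := extremalTree_isTree (d := d) (N := N)
  have hadj := extremalTree_adj_parent (d := d) j
  have hj := j.2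
  have hpar : (parent d N j : ℕ) = if (j : ℕ) < d then (j : ℕ) else d / 2 := rfl
  have hsucc : (j.succ : ℕ) = j + 1 := rfl
  by_cases hjd : (j : ℕ) < d
  · rw [if_pos hjd] at hpar ⊢
    -- The pendent vertices lie beyond the edge on the centre's side, so the side away from the
    -- centre `d / 2` is just a segment of the path.
    rcases lt_or_ge (j : ℕ) (d / 2) with hc | hc
    · rw [Sym2.eq_swap]
      refine edgeWeight_le_of_closed hT hadj.symm (Fintype.card_fin _) hk {x | (x : ℕ) ≤ j} (by simp [hpar]) ?_ ?_ ?_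
      · intro a b hab hne ha
        simp only [mem_filter, mem_univ, true_and] at ha ⊢
        by_contra! hb
        rw [extremalTree_adj] at hab
        exact hne (Sym2.eq_iff.2 (.inl ⟨by ext; omega, by ext; omega⟩))
      · refine (card_fin_filter_le (a := 0) (b := j + 1) _ fun x hx ↦ ?_).trans (by omega)
        simp only [mem_filter, mem_univ, true_and] at hx
        omega
      · omega
    · refine edgeWeight_le_of_closed hT hadj (Fintype.card_fin _) hk {x | (j : ℕ) + 1 ≤ x ∧ (x : ℕ) ≤ d}
        (by simp; omega) ?_ ?_ ?_
      · intro a b hab hne ha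
        simp only [mem_filter, mem_univ, true_and] at ha ⊢
        by_contra! hb
        rw [extremalTree_adj] at hab
        exact hne (Sym2.eq_iff.2 (.inl ⟨by ext; omega, by ext; omega⟩))
      · refine (card_fin_filter_le (a := j + 1) (b := d + 1) _ fun x hx ↦ ?_).trans (by omega)
        simp only [mem_filter, mem_univ, true_and] at hx
        omega
      · omega
  · rw [if_neg hjd] at hpar ⊢
    refine edgeWeight_le_of_closed hT hadj (Fintype.card_fin _) hk {j.succ} (by simp) ?_ (by simp) ?_
    · intro a b hab hne ha
      rw [mem_singleton] at ha
      subst ha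
      rw [extremalTree_adj] at hab
      exact absurd (Sym2.eq_iff.2 (.inl ⟨rfl, by ext; omega⟩)) hne
    · omega

lemma steinerWiener_extremalTree_le {d N k : ℕ} (hd : d ≤ N) (hk : 1 ≤ k) :
    steinerWiener k (extremalTree d (N + 1)) ≤ extremalValue (N + 1) k d := by
  classical
  rw [steinerWiener_eq_sum_edgeWeight extremalTree_isTree hk, sum_edgeFinset_extremalTree]
  refine (sum_le_sum fun j _ ↦ edgeWeight_extremalTree_le hd hk j).trans ?_
  rw [Fin.sum_univ_eq_sum_range
    (fun j ↦ cutWeight (N + 1) k (if j < d then min (j + 1) (d - j) else 1)) N, extremalValue,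
    ← sum_range_add_sum_Ico _ hd]
  refine add_le_add (sum_le_sum fun i hi ↦ ?_) ?_
  · rw [if_pos (mem_range.1 hi)]
  · rw [sum_congr rfl fun i hi ↦ by rw [if_neg (not_lt.2 (mem_Ico.1 hi).1)], sum_const,
      Nat.card_Ico, smul_eq_mul, Nat.add_sub_cancel]

end SteinerWiener

/-! ### Structure of trees attaining equality -/

namespace SteinerWiener

variable {V : Type*} [Fintype V] {G : SimpleGraph V} {d : ℕ} {p : ℕ → V}

lemma edge_ne_of_off {V : Type*} {d : ℕ} {p : ℕ → V} {w x : V} (hw : ∀ i ≤ d, p i ≠ w) :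
    ∀ i < d, s(w, x) ≠ s(p i, p (i + 1)) := by
  intro i hi h
  rcases Sym2.eq_iff.1 h with ⟨h1, -⟩ | ⟨h1, -⟩
  · exact hw i hi.le h1.symm
  · exact hw (i + 1) hi h1.symm

lemma IsPathSeq.succ_le_card_side_left (hp : IsPathSeq G d p) {w : V} (hw : ∀ i ≤ d, p i ≠ w)
    {i : ℕ} (hi : i < d) (h : w ∈ side G (p i) (p (i + 1))) :
    i + 2 ≤ #(side G (p i) (p (i + 1))) := by
  classical
  have h1 := card_le_card (insert_subset h (hp.image_subset_left hi))
  rw [card_insert_of_notMem, hp.card_image_Icc hi.le] at h1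
  · exact h1
  · intro h2
    obtain ⟨j, hj, hjw⟩ := mem_image.1 h2
    exact hw j ((mem_Icc.1 hj).2.trans hi.le) hjw

lemma IsPathSeq.succ_le_card_side_right (hp : IsPathSeq G d p) {w : V} (hw : ∀ i ≤ d, p i ≠ w)
    {i : ℕ} (hi : i < d) (h : w ∈ side G (p (i + 1)) (p i)) :
    d - i + 1 ≤ #(side G (p (i + 1)) (p i)) := by
  classical
  have h1 := card_le_card (insert_subset h (hp.image_subset_right (i := i)))
  rw [card_insert_of_notMem, hp.card_image_Icc le_rfl] at h1
  · omega
  · intro h2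
    obtain ⟨j, hj, hjw⟩ := mem_image.1 h2
    exact hw j (mem_Icc.1 hj).2 hjw

lemma mem_side_left_of_adj {w : V} (hw : ∀ i ≤ d, p i ≠ w)
    {i : ℕ} (hi : i < d) (h : G.Adj w (p i)) : w ∈ side G (p i) (p (i + 1)) := by
  refine mem_side_of_adj h.symm ?_ (self_mem_side _ _ _)
  rw [Sym2.eq_swap]
  exact edge_ne_of_off hw i hi

lemma mem_side_right_of_adj {w : V} (hw : ∀ i ≤ d, p i ≠ w)
    {i : ℕ} (hi : i < d) (h : G.Adj w (p (i + 1))) : w ∈ side G (p (i + 1)) (p i) := by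
  refine mem_side_of_adj h.symm ?_ (self_mem_side _ _ _)
  rw [Sym2.eq_swap, Sym2.eq_swap (a := p (i + 1))]
  exact edge_ne_of_off hw i hi

/-- Every edge of the path `p 0, …, p d` has a smallest possible side, and every edge outside it
is pendent. -/
structure IsTight (G : SimpleGraph V) (d : ℕ) (p : ℕ → V) : Prop where
  on_path : ∀ i < d, #(side G (p i) (p (i + 1))) = min (i + 1) (d - i) ∨
    #(side G (p (i + 1)) (p i)) = min (i + 1) (d - i)
  off_path : ∀ u v, G.Adj u v → (∀ i < d, s(u, v) ≠ s(p i, p (i + 1))) →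
    #(side G u v) = 1 ∨ #(side G v u) = 1

/-- The bound `hkd` gives strictness on the path because `min (i + 1) (d - i) ≤ (d + 1) / 2`; off
the path, `hk'` suffices. -/
lemma IsPathSeq.isTight (hp : IsPathSeq G d p) (hG : G.IsTree) {k : ℕ} (hk : 2 ≤ k)
    (hk' : k ≤ Fintype.card V - 1) (hkd : k ≤ Fintype.card V - (d + 1) / 2)
    (h : steinerWiener k G ≤ extremalValue (Fintype.card V) k d) : IsTight G d p := by
  obtain ⟨h1, h2⟩ := hp.edgeWeight_eq_of_le hG (by omega) h
  constructor
  · intro i hi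
    have h3 := h1 i hi
    rw [edgeWeight_eq hG (hp.adj i hi) (by omega)] at h3
    have h4 := card_side_add hG (hp.adj i hi)
    have h5 := hp.le_card_side_left hi
    have h6 := hp.le_card_side_right hi
    have := eq_or_of_cutWeight_eq hk (by omega) (by omega) (by omega) h3
    omega
  · intro u v huv hne
    have h3 := h2 _ huv fun hmem ↦ by
      obtain ⟨i, hi, he⟩ := mem_pathEdges.1 hmem
      exact hne i hi he.symm
    rw [edgeWeight_eq hG huv (by omega)] at h3
    have h4 := card_side_add hG huv
    have h5 := card_pos.2 ⟨u, self_mem_side G u v⟩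
    have h6 := card_pos.2 ⟨v, self_mem_side G v u⟩
    have := eq_or_of_cutWeight_eq hk h5 (by omega) hk' h3
    omega

/-- The side of `x` contains both `p 0` and `p 1`, so the singleton side must be that of `w`. -/
lemma IsTight.eq_of_mem_side (ht : IsTight G d p) (hp : IsPathSeq G d p) (hd : 1 ≤ d)
    {w x : V} (hw : ∀ i ≤ d, p i ≠ w) {h : G.Adj w x} {q : G.Walk x (p 0)}
    (hq : (SimpleGraph.Walk.cons h q).IsPath) {y : V} (hy : y ∈ side G w x) : y = w := by
  have hne := edge_ne_of_off (x := x) hw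
  have hne' : ∀ i < d, s(x, w) ≠ s(p i, p (i + 1)) := by
    rwa [Sym2.eq_swap]
  have h0 : p 0 ∈ side G x w := by
    rw [mem_side]
    refine ⟨q.toDeleteEdge s(x, w) ?_⟩
    rw [Sym2.eq_swap]
    exact (SimpleGraph.Walk.isTrail_cons _ _ |>.1 hq.isTrail).2
  have h1 := hp.mem_side_of_forall_ne hne' h0 hd
  rcases ht.off_path w x h hne with hc | hc
  · exact card_le_one.1 hc.le _ hy _ (self_mem_side _ _ _)
  · have := hp.inj 0 (by omega) 1 hd (card_le_one.1 hc.le _ h0 _ h1)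
    omega

/-- If the next vertex `x` towards `p 0` were off the path, its side away from `p 0` would be `{x}`
alone, yet it contains `w`. -/
lemma IsTight.exists_adj (ht : IsTight G d p) (hp : IsPathSeq G d p) (hG : G.Connected)
    (hd : 1 ≤ d) {w : V} (hw : ∀ i ≤ d, p i ≠ w) : ∃ i ≤ d, G.Adj w (p i) := by
  obtain ⟨q, hq⟩ := hG.exists_isPath w (p 0)
  rcases q with - | ⟨h, q⟩
  · exact absurd rfl (hw 0 (by omega))
  rename_i x
  by_contra! hcon
  have hx : ∀ i ≤ d, p i ≠ x := fun i hi hix ↦ hcon i hi (hix ▸ h)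
  rw [SimpleGraph.Walk.cons_isPath_iff] at hq
  rcases q with - | ⟨h', q⟩
  · exact hx 0 (by omega) rfl
  rename_i y
  refine h.ne (ht.eq_of_mem_side hp hd hx hq.1 (mem_side_of_adj h.symm ?_ (self_mem_side _ _ _)))
  intro he
  have : w = y := by
    rcases Sym2.eq_iff.1 he with ⟨-, h1⟩ | ⟨h1, h2⟩
    · exact h1
    · exact h2.trans h1
  apply hq.2
  rw [this]
  simp

/-- An attached vertex enlarges the side of `p i`. If `i` is far from the middle, this is the
smaller side of the path edge leading towards the middle, which then exceeds its bound. -/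
lemma IsTight.index_bounds (ht : IsTight G d p) (hp : IsPathSeq G d p) {w : V}
    (hw : ∀ i ≤ d, p i ≠ w) {i : ℕ} (hi : i ≤ d) (h : G.Adj w (p i)) :
    d ≤ 2 * i + 1 ∧ 2 * i ≤ d + 1 := by
  constructor
  · by_contra! hc
    have hid : i < d := by omega
    have h1 := hp.succ_le_card_side_left hw hid (mem_side_left_of_adj hw hid h)
    have h2 := hp.le_card_side_right hid
    have := ht.on_path i hid
    omega
  · by_contra! hc
    obtain ⟨i, rfl⟩ : ∃ j, i = j + 1 := ⟨i - 1, by omega⟩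
    have h1 := hp.succ_le_card_side_right hw hi (mem_side_right_of_adj hw hi h)
    have h2 := hp.le_card_side_left hi
    have := ht.on_path i hi
    omega

/-- Otherwise both sides of the middle edge would exceed `i + 1`. -/
lemma IsTight.not_adj_consecutive (ht : IsTight G d p) (hp : IsPathSeq G d p) {w w' : V}
    (hw : ∀ i ≤ d, p i ≠ w) (hw' : ∀ i ≤ d, p i ≠ w') {i : ℕ} (hi : d = 2 * i + 1)
    (h : G.Adj w (p i)) : ¬ G.Adj w' (p (i + 1)) := by
  intro h'
  have hid : i < d := by omega
  have h1 := hp.succ_le_card_side_left hw hid (mem_side_left_of_adj hw hid h)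
  have h2 := hp.succ_le_card_side_right hw' hid (mem_side_right_of_adj hw' hid h')
  have := ht.on_path i hid
  omega

lemma IsTight.exists_centred (ht : IsTight G d p) (hp : IsPathSeq G d p) (hG : G.Connected)
    (hd : 1 ≤ d) : ∃ q, IsPathSeq G d q ∧
      ∀ w, (∀ i ≤ d, q i ≠ w) → G.Adj w (q (d / 2)) := by
  by_cases hc : ∀ w, (∀ i ≤ d, p i ≠ w) → G.Adj w (p (d / 2))
  · exact ⟨p, hp, hc⟩
  push Not at hc
  obtain ⟨w, hw, hwc⟩ := hc
  obtain ⟨i, hi, hwi⟩ := ht.exists_adj hp hG hd hw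
  have h1 := ht.index_bounds hp hw hi hwi
  have hne : i ≠ d / 2 := by
    rintro rfl
    exact hwc hwi
  have hi' : i = d / 2 + 1 := by omega
  subst hi'
  -- Here `d` is odd and everything hangs from the other centre `d / 2 + 1`; reversal moves it to
  -- index `d / 2`.
  refine ⟨_, hp.reverse, fun w' hw' ↦ ?_⟩
  have hw'' : ∀ j ≤ d, p j ≠ w' := fun j hj ↦ by
    have := hw' (d - j) (by omega)
    rwa [Nat.sub_sub_self hj] at this
  obtain ⟨j, hj, hwj⟩ := ht.exists_adj hp hG hd hw''
  have h2 := ht.index_bounds hp hw'' hj hwj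
  by_cases hj2 : j = d / 2
  · subst hj2
    exact absurd hwi (ht.not_adj_consecutive hp hw'' hw (by omega) hwj)
  · rwa [show d - d / 2 = j by omega]

lemma IsPathSeq.nonempty_iso (hp : IsPathSeq G d p) (hG : G.IsTree)
    (hc : ∀ w, (∀ i ≤ d, p i ≠ w) → G.Adj w (p (d / 2))) {N : ℕ} (hN : Fintype.card V = N + 1) :
    Nonempty (G ≃g extremalTree d (N + 1)) := by
  classical
  let S : Finset V := ((Icc 0 d).image p)ᶜ
  have hS : #S = N + 1 - (d + 1) := by
    rw [card_compl, hp.card_image_Icc le_rfl, hN, Nat.sub_zero]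
  have hmem : ∀ w ∈ S, ∀ i ≤ d, p i ≠ w := by
    intro w hw i hi h
    exact mem_compl.1 hw (mem_image.2 ⟨i, by simpa using hi, h⟩)
  let e := S.equivFinOfCardEq hS
  let f : Fin (N + 1) → V := fun j ↦
    if h : (j : ℕ) ≤ d then p j else e.symm ⟨j - (d + 1), by omega⟩
  have hf1 : ∀ j : Fin (N + 1), (j : ℕ) ≤ d → f j = p j := fun j hj ↦ dif_pos hj
  have hf2 : ∀ j : Fin (N + 1), d < (j : ℕ) → f j ∈ S := fun j hj ↦ by
    simp only [f, dif_neg (not_le.2 hj)]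
    exact Subtype.prop _
  have hinj : Function.Injective f := by
    intro a b hab
    rcases le_or_gt (a : ℕ) d with ha | ha <;> rcases le_or_gt (b : ℕ) d with hb | hb
    · rw [hf1 a ha, hf1 b hb] at hab
      exact Fin.ext (hp.inj _ ha _ hb hab)
    · rw [hf1 a ha] at hab
      exact absurd hab (hmem _ (hf2 b hb) _ ha)
    · rw [hf1 b hb] at hab
      exact absurd hab.symm (hmem _ (hf2 a ha) _ hb)
    · simp only [f, dif_neg (not_le.2 ha), dif_neg (not_le.2 hb)] at hab
      have := e.symm.injective (Subtype.ext hab)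
      rw [Fin.mk.injEq] at this
      exact Fin.ext (by omega)
  have hbij : Function.Bijective f :=
    (Fintype.bijective_iff_injective_and_card f).2 ⟨hinj, by simp [hN]⟩
  let φ : Fin (N + 1) ≃ V := Equiv.ofBijective f hbij
  have key : ∀ i j : Fin (N + 1), (((i : ℕ) + 1 = (j : ℕ) ∧ (j : ℕ) ≤ d) ∨
      ((i : ℕ) = d / 2 ∧ d < (j : ℕ))) → G.Adj (f i) (f j) := by
    rintro i j (⟨h1, h2⟩ | ⟨h1, h2⟩)
    · rw [hf1 i (by omega), hf1 j h2, ← h1]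
      exact hp.adj _ (by omega)
    · rw [hf1 i (by omega), h1]
      exact (hc _ (hmem _ (hf2 j h2))).symm
  have hle : extremalTree d (N + 1) ≤ G.comap φ := by
    intro i j hij
    rw [extremalTree_adj] at hij
    rcases hij.2 with h | h
    · exact key i j h
    · exact (key j i h).symm
  have hT : (G.comap φ).IsTree := (SimpleGraph.Iso.comap φ G).isTree_iff.2 hG
  -- One inclusion is enough, since a tree is a minimal connected graph.
  have heq : extremalTree d (N + 1) = G.comap φ :=
    le_antisymm hle
      ((SimpleGraph.isTree_iff_minimal_connected.1 hT).2 extremalTree_isTree.connected hle)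
  rw [heq]
  exact ⟨(SimpleGraph.Iso.comap φ G).symm⟩

end SteinerWiener

theorem corollary7 {V : Type*} [Fintype V] (T : SimpleGraph V) (hT : T.IsTree)
    (n d k : ℕ) (hn : Fintype.card V = n) (hd : T.diam = d) (hk2 : 2 ≤ k) (hkn : k ≤ n - 1) :
    SteinerWiener.steinerWiener k (SteinerWiener.extremalTree d n) ≤
        SteinerWiener.steinerWiener k T ∧
      ((k : ℤ) ≤ (n : ℤ) - ⌈(d : ℚ) / 2⌉ →
        SteinerWiener.steinerWiener k T =
            SteinerWiener.steinerWiener k (SteinerWiener.extremalTree d n) →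
          Nonempty (T ≃g SteinerWiener.extremalTree d n)) := by
  obtain ⟨N, rfl⟩ : ∃ N, n = N + 1 := ⟨n - 1, by omega⟩
  obtain ⟨p, hp⟩ := SteinerWiener.exists_isPathSeq_diam hT.connected
  rw [hd] at hp
  have hdN := hp.succ_le_card
  rw [hn] at hdN
  have hle := hp.extremalValue_le hT (k := k) (by omega)
  have hge := SteinerWiener.steinerWiener_extremalTree_le (d := d) (N := N) (k := k)
    (by omega) (by omega)
  rw [hn] at hle
  refine ⟨hge.trans hle, fun hkd heq ↦ ?_⟩
  have hnt : Nontrivial V := Fintype.one_lt_card_iff_nontrivial.1 (by omega)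
  have hne := hT.connected.nonempty
  have hd1 : 1 ≤ d := by
    rw [← hd]
    exact Nat.one_le_iff_ne_zero.2 (SimpleGraph.diam_ne_zero_of_ediam_ne_top
      (SimpleGraph.connected_iff_ediam_ne_top.1 hT.connected))
  -- Converts the rational ceiling into the natural division used in `IsPathSeq.isTight`; only this
  -- inequality is needed.
  have hceil : (((d + 1) / 2 : ℕ) : ℤ) ≤ ⌈(d : ℚ) / 2⌉ := by
    rw [Int.le_ceil_iff]
    have h : 2 * ((d + 1) / 2) < d + 2 := by omega
    have h' : (2 : ℚ) * (((d + 1) / 2 : ℕ) : ℚ) < d + 2 := by exact_mod_cast h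
    rw [Int.cast_natCast]
    linarith
  have ht := hp.isTight hT hk2 (by omega) (by omega) (by rw [hn]; omega)
  obtain ⟨q, hq, hc⟩ := ht.exists_centred hp hT.connected hd1
  exact hq.nonempty_iso hT hc hn
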